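/- A group $G$ is called fully residually free if for every finite list of distinct elements $g_1,\dots,g_k\in G$ there is a surjective homomorphism $\theta$ from $G$ onto a free group $F$ (which may depend on the list) such that $\theta(g_1),\dots,\theta(g_k)$ are distinct. Let $G$ be a fully residually free group (for example a limit group, that is, a finitely generated fully residually free group), and let $A$ be any finite subset of $G$. Write $A^3=\{abc : a,b,c\in A\}$, and let $\langle A\rangle$ be the subgroup of $G$ generated by $A$. Then either $|A^3|\ge \frac{1}{7776}|A|^2$, or $\langle A\rangle$ is a free abelian subgroup of $G$ (possibly trivial). -/

import Mathlib

open scoped Pointwise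

universe u

/-- A group `G` is fully residually free if for any finite set of (distinct) elements of `G` there
is a surjective homomorphism from `G` onto a free group that keeps those elements distinct. The
free group may depend on the elements; being a quotient of `G`, it may be taken in the universe
of `G`. -/
def IsFullyResiduallyFree (G : Type u) [Group G] : Prop :=
  ∀ S : Finset G, ∃ (X : Type u) (θ : G →* FreeGroup X),
    Function.Surjective θ ∧ Set.InjOn θ (S : Set G)

/-- A (multiplicative) group is free abelian if it is isomorphic to the free abelian group on
some set (possibly empty, in which case the group is trivial). -/
def IsFreeAbelian (H : Type u) [Group H] : Prop :=
  ∃ X : Type u, Nonempty (H ≃* Multiplicative (FreeAbelianGroup X))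

/-!
If `A` commutes, then the subgroup it generates is finitely generated, abelian and torsion-free
(roots are unique in free groups, hence in fully residually free groups), so it is free abelian. If
two elements of `A` do not commute, a homomorphism to a free group that is injective on `A` and
keeps them from commuting reduces the inequality to a free group; there the argument is Safin's.
Sets with at most `7776` elements are trivial, as `|A ^ 3| ≥ |A|`.

In a free group, conjugate `A` so that the total word length is minimal (`exists_conj_balanced`).
Then the letters can be divided into two classes such that many products of elements of `A` are
reduced as written: there are `U, B ⊆ A`, each with at least `|A| / 36` elements, such that the
elements of `B` are at least as long as those of `U` and all products `u * b * u'` are free of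
cancellation (`exists_reduced_subsets`). This turns the problem into one about words. If for some
`b` each word has few representations `u * b * u'`, then `U * {b} * U` has at least
`|U| ^ 2 / 6` elements. Otherwise, three representations of one word give overlapping occurrences
of `b`, hence a period `c` of `b` of length at most `|b| / 2`, and moreover most of `U` is obtained
from few words (`bases U c`) by appending powers of `c`. The last property determines `c`
independently of `b` (`commute_of_card_bases_lt`). With the same information from the right it
follows that all `b ∈ B` conjugate one nontrivial word `s` to one word `e`
(`FreeMonoid.exists_common_period`).

Thus `B` lies in a coset of the centralizer of `s`. Centralizers in free groups are cyclic and
malnormal, by the Nielsen-Schreier theorem, so for some `c ∈ A` the products `b * c * b'` with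
`b, b' ∈ B` are pairwise different, unless `A` is commutative
(`sq_card_le_card_pow_three_or_commute`). In each case `|A ^ 3| ≥ |A| ^ 2 / (36 ^ 2 * 6)`.
-/

/-! ### Words: periods and roots -/

namespace FreeMonoid

variable {α : Type*}

/-- Of two prefixes of a word, the shorter one is a prefix of the longer one. -/
theorem exists_mul_of_mul_eq_mul {a b c d : FreeMonoid α} (h : a * b = c * d)
    (hl : a.length ≤ c.length) : ∃ t, c = a * t ∧ b = t * d := by
  rcases List.append_eq_append_iff.mp (show a.toList ++ b.toList = c.toList ++ d.toList from h) with
    ⟨t, h1, h2⟩ | ⟨t, h1, h2⟩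
  · exact ⟨ofList t, h1, h2⟩
  · have h1' : a = c * ofList t := h1
    have h2' : d = ofList t * b := h2
    have : (ofList t).length = 0 := by
      rw [h1', length_mul] at hl
      omega
    rw [length_eq_zero] at this
    exact ⟨1, by simp [h1', this], by simp [h2', this]⟩

theorem eq_of_mul_eq_mul_of_length_eq {a b c d : FreeMonoid α} (h : a * b = c * d)
    (hl : a.length = c.length) : a = c := by
  obtain ⟨t, rfl, -⟩ := exists_mul_of_mul_eq_mul h hl.le
  rw [length_mul] at hl
  have : t = 1 := length_eq_zero.mp (by omega)
  simp [this]

theorem length_pow (p : FreeMonoid α) (n : ℕ) : (p ^ n).length = n * p.length := by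
  induction n with
  | zero => simp
  | succ n ih => rw [pow_succ, length_mul, ih]; ring

theorem length_pos {p : FreeMonoid α} (hp : p ≠ 1) : 0 < p.length :=
  Nat.pos_of_ne_zero fun h => hp (length_eq_zero.mp h)

theorem le_length_pow {p : FreeMonoid α} (hp : p ≠ 1) (n : ℕ) : n ≤ (p ^ n).length := by
  rw [length_pow]
  exact Nat.le_mul_of_pos_right _ (length_pos hp)

/-- Two words commuting with a common nontrivial word `p` are both prefixes of a power of `p`, so
the shorter one is a prefix of the longer one, and the quotient commutes with `p` again. -/
theorem exists_mul_of_commute {p y z : FreeMonoid α} (hp : p ≠ 1) (hy : Commute y p)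
    (hz : Commute z p) (hl : y.length ≤ z.length) : ∃ t, z = y * t ∧ Commute t p := by
  obtain ⟨s, hs, -⟩ := exists_mul_of_mul_eq_mul (hy.pow_right z.length).eq
    (hl.trans (le_length_pow hp _))
  obtain ⟨s', hs', -⟩ := exists_mul_of_mul_eq_mul (hz.pow_right z.length).eq (le_length_pow hp _)
  obtain ⟨t, rfl, -⟩ := exists_mul_of_mul_eq_mul (hs.symm.trans hs') hl
  refine ⟨t, rfl, ?_⟩
  have h := hz.eq
  rw [mul_assoc, ← mul_assoc p, ← hy.eq, mul_assoc] at h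
  exact mul_left_cancel h

theorem eq_of_commute_of_length_eq {p y z : FreeMonoid α} (hp : p ≠ 1) (hy : Commute y p)
    (hz : Commute z p) (hl : y.length = z.length) : y = z := by
  obtain ⟨t, rfl, -⟩ := exists_mul_of_commute hp hy hz hl.le
  rw [length_mul] at hl
  have : t = 1 := length_eq_zero.mp (by omega)
  simp [this]

/-- A word is primitive if it is nontrivial and only its own powers commute with it. -/
def IsPrimitive (c : FreeMonoid α) : Prop :=
  c ≠ 1 ∧ ∀ z, Commute z c → ∃ k : ℕ, z = c ^ k

/-- The root of `p` is the shortest nontrivial word commuting with `p`. -/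
theorem exists_isPrimitive_pow {p : FreeMonoid α} (hp : p ≠ 1) :
    ∃ c k, IsPrimitive c ∧ p = c ^ k := by
  classical
  have hex : ∃ n, ∃ c : FreeMonoid α, c ≠ 1 ∧ Commute c p ∧ c.length = n :=
    ⟨_, p, hp, Commute.refl p, rfl⟩
  obtain ⟨c, hc1, hcp, hcl⟩ := Nat.find_spec hex
  have hmin : ∀ r : FreeMonoid α, r ≠ 1 → Commute r p → c.length ≤ r.length := fun r hr hrp =>
    hcl.le.trans (Nat.find_min' hex ⟨r, hr, hrp, rfl⟩)
  have key : ∀ n, ∀ z : FreeMonoid α, z.length ≤ n → Commute z p → ∃ k : ℕ, z = c ^ k := by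
    intro n
    induction n with
    | zero =>
      intro z hz _
      exact ⟨0, by simpa using length_eq_zero.mp (Nat.le_zero.mp hz)⟩
    | succ n ih =>
      intro z hz hzp
      by_cases h1 : z = 1
      · exact ⟨0, by simp [h1]⟩
      · obtain ⟨t, rfl, ht⟩ := exists_mul_of_commute hp hcp hzp (hmin z h1 hzp)
        have := length_pos hc1
        rw [length_mul] at hz
        obtain ⟨k, rfl⟩ := ih t (by omega) ht
        exact ⟨k + 1, (pow_succ' c k).symm⟩
  obtain ⟨k, hk⟩ := key _ p le_rfl (Commute.refl p)
  refine ⟨c, k, ⟨hc1, fun z hz => key _ z le_rfl ?_⟩, hk⟩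
  rw [hk]
  exact hz.pow_right k

/-- `p` is a period of `b` if `b` is a prefix of `p * b`, that is, of a power of `p`. -/
def IsPeriod (p b : FreeMonoid α) : Prop := ∃ t, p * b = b * t

/-- A weak form of the theorem of Fine and Wilf: two periods of `b` whose lengths add up to at most
the length of `b` commute, as both their products are prefixes of `b`. -/
theorem IsPeriod.commute {p r b : FreeMonoid α} (hp : IsPeriod p b) (hr : IsPeriod r b)
    (hl : p.length + r.length ≤ b.length) : Commute p r := by
  obtain ⟨t, ht⟩ := hp
  obtain ⟨s, hs⟩ := hr
  obtain ⟨b₁, hb₁, -⟩ := exists_mul_of_mul_eq_mul ht (by omega)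
  obtain ⟨b₂, hb₂, -⟩ := exists_mul_of_mul_eq_mul hs (by omega)
  obtain ⟨x, hx, -⟩ := exists_mul_of_mul_eq_mul (a := p * r) (b := b₂) (c := b) (d := t)
    (by rw [mul_assoc, ← hb₂, ht]) (by rw [length_mul]; omega)
  obtain ⟨y, hy, -⟩ := exists_mul_of_mul_eq_mul (a := r * p) (b := b₁) (c := b) (d := s)
    (by rw [mul_assoc, ← hb₁, hs]) (by rw [length_mul]; omega)
  exact eq_of_mul_eq_mul_of_length_eq (hx.symm.trans hy) (by rw [length_mul, length_mul, add_comm])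

theorem IsPeriod.of_pow {c b : FreeMonoid α} {k : ℕ} (hc : c ≠ 1) (hk : k ≠ 0)
    (h : IsPeriod (c ^ k) b) : IsPeriod c b := by
  obtain ⟨t, ht⟩ := h
  have hpow : ∀ n : ℕ, (c ^ k) ^ n * b = b * t ^ n := by
    intro n
    induction n with
    | zero => simp
    | succ n ih => rw [pow_succ, mul_assoc, ht, ← mul_assoc, ih, mul_assoc, ← pow_succ]
  have hlen : b.length ≤ ((c ^ k) ^ b.length).length := by
    rw [← pow_mul]
    exact (Nat.le_mul_of_pos_left _ (Nat.pos_of_ne_zero hk)).trans (le_length_pow hc _)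
  obtain ⟨s, hs, -⟩ := exists_mul_of_mul_eq_mul (hpow b.length).symm hlen
  have h1 : (c * b) * s = b * (s * c) := by
    rw [mul_assoc, ← hs, ← mul_assoc, ← hs, ← pow_mul, ← pow_succ, ← pow_succ']
  obtain ⟨t', ht', -⟩ := exists_mul_of_mul_eq_mul h1.symm (by rw [length_mul]; omega)
  exact ⟨t', ht'⟩

theorem reverse_pow (c : FreeMonoid α) (n : ℕ) : (c ^ n).reverse = c.reverse ^ n := by
  induction n with
  | zero => rfl
  | succ n ih => rw [pow_succ, reverse_mul, ih, pow_succ']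

theorem reverse_ne_one {c : FreeMonoid α} (hc : c ≠ 1) : c.reverse ≠ 1 := fun h => hc <| by
  rw [← length_eq_zero, ← length_reverse, h, length_one]

/-- If both `u` and `u * c ^ j` end with the square of `d`, then `c` is a period of that square
read backwards, hence commutes with `d` when it is not longer than `d`. -/
theorem commute_of_square_suffix {c d u g h : FreeMonoid α} {j : ℕ} (hc : c ≠ 1) (hj : j ≠ 0)
    (hl : c.length ≤ d.length) (hg : u = g * (d * d)) (hh : u * c ^ j = h * (d * d)) :
    Commute c d := by
  have h1 : (c ^ j).reverse * (d * d).reverse * g.reverse = (d * d).reverse * h.reverse := by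
    rw [mul_assoc, ← reverse_mul, ← reverse_mul, ← reverse_mul, ← hh, ← hg]
  obtain ⟨t, ht, -⟩ := exists_mul_of_mul_eq_mul h1.symm (by rw [length_mul]; omega)
  have hpc : IsPeriod c.reverse (d * d).reverse :=
    IsPeriod.of_pow (reverse_ne_one hc) hj ⟨t, by rw [← reverse_pow]; exact ht⟩
  have hpd : IsPeriod d.reverse (d * d).reverse := ⟨d.reverse, by simp [reverse_mul, mul_assoc]⟩
  have h2 := (hpc.commute hpd (by simp only [length_reverse, length_mul]; omega)).eq
  have h3 := congrArg reverse h2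
  simp only [reverse_mul, reverse_reverse] at h3
  exact h3.symm

/-! ### Bases for the powers of a word -/

section Bases

open Classical in
/-- The elements of `U` that are not obtained from another element of `U` by appending a
nontrivial power of `c`. -/
noncomputable def bases (U : Finset (FreeMonoid α)) (c : FreeMonoid α) : Finset (FreeMonoid α) :=
  U.filter fun u => ∀ v ∈ U, ∀ k : ℕ, k ≠ 0 → u ≠ v * c ^ k

theorem bases_subset (U : Finset (FreeMonoid α)) (c : FreeMonoid α) : bases U c ⊆ U := by
  classical
  exact Finset.filter_subset _ _

theorem ne_of_mem_bases {U : Finset (FreeMonoid α)} {c u v : FreeMonoid α} {k : ℕ}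
    (hu : u ∈ bases U c) (hv : v ∈ U) (hk : k ≠ 0) : u ≠ v * c ^ k := by
  classical
  exact (Finset.mem_filter.mp hu).2 v hv k hk

theorem exists_mem_bases {U : Finset (FreeMonoid α)} {c : FreeMonoid α} (hc : c ≠ 1)
    {u : FreeMonoid α} (hu : u ∈ U) : ∃ v ∈ bases U c, ∃ k : ℕ, u = v * c ^ k := by
  induction hn : u.length using Nat.strong_induction_on generalizing u with
  | _ n ih =>
    by_cases h : u ∈ bases U c
    · exact ⟨u, h, 0, by simp⟩
    · simp only [bases, Finset.mem_filter, hu, true_and] at h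
      push Not at h
      obtain ⟨v, hv, k, hk, rfl⟩ := h
      have hlt : v.length < n := by
        rw [← hn, length_mul]
        have := le_length_pow hc k
        omega
      obtain ⟨w, hw, j, rfl⟩ := ih _ hlt hv rfl
      exact ⟨w, hw, j + k, by rw [mul_assoc, pow_add]⟩

/-- An element of `U` ends with `d * d` unless it is at most one `d` away from a base for `d`;
and, if `c` and `d` do not commute, at most one element over each base for `c` ends with
`d * d`. -/
theorem card_le_of_not_commute {U : Finset (FreeMonoid α)} {c d : FreeMonoid α} (hc : c ≠ 1)
    (hd : d ≠ 1) (hl : c.length ≤ d.length) (hcd : ¬ Commute c d) :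
    U.card ≤ (bases U c).card + 2 * (bases U d).card := by
  classical
  have hcov : U ⊆ (U.filter fun u => ∃ g, u = g * (d * d)) ∪
      (bases U d ∪ (bases U d).image (· * d)) := by
    intro u hu
    obtain ⟨v, hv, k, rfl⟩ := exists_mem_bases hd hu
    simp only [Finset.mem_union, Finset.mem_filter, Finset.mem_image]
    match k with
    | 0 => right; left; simpa using hv
    | 1 => right; right; exact ⟨v, hv, by simp⟩
    | k + 2 => left; exact ⟨hu, v * d ^ k, by simp [pow_succ, mul_assoc]⟩
  have hE : (U.filter fun u => ∃ g, u = g * (d * d)).card ≤ (bases U c).card := by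
    have hb : ∀ u ∈ U, ∃ v, v ∈ bases U c ∧ ∃ k : ℕ, u = v * c ^ k := fun u hu =>
      let ⟨v, hv, k, hk⟩ := exists_mem_bases hc hu
      ⟨v, hv, k, hk⟩
    choose! f hf hfk using hb
    refine Finset.card_le_card_of_injOn f
      (fun u hu => hf u (Finset.mem_of_mem_filter u hu)) ?_
    have aux : ∀ u w : FreeMonoid α, ∀ v : FreeMonoid α, ∀ i j : ℕ, i < j → u = v * c ^ i →
        w = v * c ^ j → (∃ g, u = g * (d * d)) → (∃ g, w = g * (d * d)) → False := by
      rintro u w v i j hij hu hw ⟨g, hg⟩ ⟨h, hh⟩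
      refine hcd (commute_of_square_suffix (j := j - i) hc (by omega) hl hg (h := h) ?_)
      rw [hu, mul_assoc, ← pow_add, Nat.add_sub_cancel' hij.le, ← hw, hh]
    intro u hu w hw huw
    simp only [Finset.coe_filter, Set.mem_ofPred_eq] at hu hw
    obtain ⟨i, hi⟩ := hfk u hu.1
    obtain ⟨j, hj⟩ := hfk w hw.1
    rw [← huw] at hj
    rcases lt_trichotomy i j with h | h | h
    · exact (aux _ _ _ _ _ h hi hj hu.2 hw.2).elim
    · rw [hi, hj, h]
    · exact (aux _ _ _ _ _ h hj hi hw.2 hu.2).elim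
  have h1 := Finset.card_le_card hcov
  have h2 := Finset.card_union_le (U.filter fun u => ∃ g, u = g * (d * d))
      (bases U d ∪ (bases U d).image (· * d))
  have h3 := Finset.card_union_le (bases U d) ((bases U d).image (· * d))
  have h4 : ((bases U d).image (· * d)).card ≤ (bases U d).card := Finset.card_image_le
  omega

theorem commute_of_card_bases_lt {U : Finset (FreeMonoid α)} {c d : FreeMonoid α} (hc : c ≠ 1)
    (hd : d ≠ 1) (h1 : 3 * (bases U c).card < U.card) (h2 : 3 * (bases U d).card < U.card) :
    Commute c d := by
  by_contra h
  rcases le_total c.length d.length with hl | hl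
  · have := card_le_of_not_commute (U := U) hc hd hl h
    omega
  · have := card_le_of_not_commute (U := U) hd hc hl fun h' => h h'.symm
    omega

end Bases

/-! ### Coincidences among products of three words -/

section Triple

/-- Two different ways of splitting a word as `u * b * v`, at positions not further apart than the
length of `b`, give a period of `b`. -/
theorem exists_isPeriod {u v u' v' b : FreeMonoid α} (h : u * b * v = u' * b * v')
    (hl : u.length < u'.length) (hb : u'.length ≤ u.length + b.length) :
    ∃ p, p ≠ 1 ∧ u' = u * p ∧ IsPeriod p b := by
  rw [mul_assoc, mul_assoc] at h
  obtain ⟨p, rfl, hp⟩ := exists_mul_of_mul_eq_mul h hl.le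
  rw [← mul_assoc] at hp
  obtain ⟨t, ht, -⟩ := exists_mul_of_mul_eq_mul hp (by rw [length_mul]; omega)
  refine ⟨p, ?_, rfl, t, ht⟩
  rintro rfl
  simp at hl

/-- Three occurrences of `b` produce two consecutive gaps, the shorter of which is at most half
as long as `b`. -/
theorem exists_short_isPeriod {u₁ u₂ u₃ v₁ v₂ v₃ b : FreeMonoid α}
    (h12 : u₁ * b * v₁ = u₂ * b * v₂) (h23 : u₂ * b * v₂ = u₃ * b * v₃)
    (hl12 : u₁.length < u₂.length) (hl23 : u₂.length < u₃.length) (hb : u₃.length ≤ b.length) :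
    ∃ p, p ≠ 1 ∧ IsPeriod p b ∧ 2 * p.length ≤ b.length ∧ (u₂ = u₁ * p ∨ u₃ = u₂ * p) := by
  obtain ⟨p, hp1, hp, hpb⟩ := exists_isPeriod h12 hl12 (by omega)
  obtain ⟨r, hr1, hr, hrb⟩ := exists_isPeriod h23 hl23 (by omega)
  have e1 : u₂.length = u₁.length + p.length := by rw [hp, length_mul]
  have e2 : u₃.length = u₂.length + r.length := by rw [hr, length_mul]
  rcases le_total p.length r.length with h | h
  · exact ⟨p, hp1, hpb, by omega, Or.inl hp⟩
  · exact ⟨r, hr1, hrb, by omega, Or.inr hr⟩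

variable [DecidableEq (FreeMonoid α)]

/-- If no word has three representations `u * b * v` with `u ∈ U`, `v ∈ V`, then there are at least
half as many such words as pairs. -/
theorem card_mul_card_le_two_mul {U V : Finset (FreeMonoid α)} {b : FreeMonoid α}
    (h : ∀ u₁ ∈ U, ∀ u₂ ∈ U, ∀ u₃ ∈ U, ∀ v₁ v₂ v₃, u₁ * b * v₁ = u₂ * b * v₂ →
      u₂ * b * v₂ = u₃ * b * v₃ → u₁.length < u₂.length → ¬ u₂.length < u₃.length) :
    U.card * V.card ≤ 2 * ((U ×ˢ V).image fun x => x.1 * b * x.2).card := by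
  rw [← Finset.card_product]
  refine Finset.card_le_mul_card_image _ _ fun w _ => ?_
  by_contra hlt
  push Not at hlt
  obtain ⟨x, hx, y, hy, z, hz, hxy, hxz, hyz⟩ := Finset.two_lt_card.mp hlt
  simp only [Finset.mem_filter, Finset.mem_product] at hx hy hz
  have key : ∀ x y : FreeMonoid α × FreeMonoid α, x.1 * b * x.2 = w → y.1 * b * y.2 = w →
      x ≠ y → x.1.length ≠ y.1.length := by
    intro x y hx hy hxy hl
    have h0 : x.1 * b * x.2 = y.1 * b * y.2 := hx.trans hy.symm
    have h1 : x.1 = y.1 := eq_of_mul_eq_mul_of_length_eq (b := b * x.2) (d := b * y.2)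
      (by rw [← mul_assoc, ← mul_assoc]; exact h0) hl
    rw [h1] at h0
    exact hxy (Prod.ext h1 (mul_left_cancel h0))
  have H := fun (x y z : FreeMonoid α × FreeMonoid α) hx1 hy1 hz1 (hx : x.1 * b * x.2 = w)
      (hy : y.1 * b * y.2 = w) (hz : z.1 * b * z.2 = w) =>
    h x.1 hx1 y.1 hy1 z.1 hz1 x.2 y.2 z.2 (hx.trans hy.symm) (hy.trans hz.symm)
  have k1 := key x y hx.2 hy.2 hxy
  have k2 := key x z hx.2 hz.2 hxz
  have k3 := key y z hy.2 hz.2 hyz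
  have h1 := H x y z hx.1.1 hy.1.1 hz.1.1 hx.2 hy.2 hz.2
  have h2 := H x z y hx.1.1 hz.1.1 hy.1.1 hx.2 hz.2 hy.2
  have h3 := H y x z hy.1.1 hx.1.1 hz.1.1 hy.2 hx.2 hz.2
  have h4 := H y z x hy.1.1 hz.1.1 hx.1.1 hy.2 hz.2 hx.2
  have h5 := H z x y hz.1.1 hx.1.1 hy.1.1 hz.2 hx.2 hy.2
  have h6 := H z y x hz.1.1 hy.1.1 hx.1.1 hz.2 hy.2 hx.2
  omega

/-- If a primitive word `c` is a short period of `b`, then all short periods of `b` are powers of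
`c`, so no word has three representations `u * b * v` with `u` in `bases U c`. -/
theorem card_bases_mul_card_le {U V : Finset (FreeMonoid α)} {b c : FreeMonoid α}
    (hU : ∀ u ∈ U, u.length ≤ b.length) (hc : IsPrimitive c) (hcb : IsPeriod c b)
    (hl : 2 * c.length ≤ b.length) :
    (bases U c).card * V.card ≤ 2 * ((U ×ˢ V).image fun x => x.1 * b * x.2).card := by
  have hsub := bases_subset U c
  refine (card_mul_card_le_two_mul (U := bases U c) (V := V) (b := b) ?_).trans
    (Nat.mul_le_mul_left 2 (Finset.card_le_card
      (Finset.image_subset_image (Finset.product_subset_product_left hsub))))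
  intro u₁ h₁ u₂ h₂ u₃ h₃ v₁ v₂ v₃ e12 e23 l12 l23
  obtain ⟨p, hp1, hpb, hpl, hor⟩ :=
    exists_short_isPeriod e12 e23 l12 l23 (hU u₃ (hsub h₃))
  obtain ⟨k, rfl⟩ := hc.2 p (hpb.commute hcb (by omega))
  have hk : k ≠ 0 := by
    rintro rfl
    exact hp1 (pow_zero c)
  rcases hor with h | h
  · exact ne_of_mem_bases h₂ (hsub h₁) hk h
  · exact ne_of_mem_bases h₃ (hsub h₂) hk h

/-- If every `b ∈ B` produces many coincidences, then each has a short primitive period over which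
`U` has few bases; by `commute_of_card_bases_lt` these periods all coincide. -/
theorem exists_common_left_period {U V B : Finset (FreeMonoid α)} (hB : B.Nonempty)
    (hU : ∀ b ∈ B, ∀ u ∈ U, u.length ≤ b.length) :
    (∃ b ∈ B, U.card * V.card ≤ 6 * ((U ×ˢ V).image fun x => x.1 * b * x.2).card) ∨
      ∃ c, c ≠ 1 ∧ ∀ b ∈ B, IsPeriod c b ∧ 2 * c.length ≤ b.length := by
  by_cases hsmall : ∃ b ∈ B, U.card * V.card ≤ 6 * ((U ×ˢ V).image fun x => x.1 * b * x.2).card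
  · exact Or.inl hsmall
  right
  push Not at hsmall
  have hper : ∀ b ∈ B, ∃ c, IsPrimitive c ∧ IsPeriod c b ∧ 2 * c.length ≤ b.length ∧
      3 * (bases U c).card < U.card := by
    intro b hb
    have hlt := hsmall b hb
    obtain ⟨p, hp1, hpb, hpl⟩ : ∃ p, p ≠ 1 ∧ IsPeriod p b ∧ 2 * p.length ≤ b.length := by
      by_contra hno
      push Not at hno
      have := card_mul_card_le_two_mul (U := U) (V := V) (b := b) (by
        intro u₁ h₁ u₂ h₂ u₃ h₃ v₁ v₂ v₃ e12 e23 l12 l23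
        obtain ⟨p, hp1, hpb, hpl, -⟩ := exists_short_isPeriod e12 e23 l12 l23 (hU b hb u₃ h₃)
        exact absurd hpl (not_le.mpr (hno p hp1 hpb)))
      omega
    obtain ⟨c, k, hc, rfl⟩ := exists_isPrimitive_pow hp1
    have hk : k ≠ 0 := by
      rintro rfl
      exact hp1 (pow_zero c)
    have hcb := hpb.of_pow hc.1 hk
    have hcl : 2 * c.length ≤ b.length := by
      rw [length_pow] at hpl
      have := Nat.le_mul_of_pos_left c.length (Nat.pos_of_ne_zero hk)
      omega
    refine ⟨c, hc, hcb, hcl, ?_⟩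
    have hle := card_bases_mul_card_le (V := V) (hU b hb) hc hcb hcl
    by_contra hcon
    push Not at hcon
    have := Nat.mul_le_mul_right V.card hcon
    rw [mul_assoc] at this
    omega
  obtain ⟨b₀, hb₀⟩ := hB
  obtain ⟨c, hc, -, -, hcs⟩ := hper b₀ hb₀
  refine ⟨c, hc.1, fun b hb => ?_⟩
  obtain ⟨d, hd, hdb, hdl, hds⟩ := hper b hb
  obtain ⟨k, rfl⟩ := hc.2 d (commute_of_card_bases_lt hd.1 hc.1 hds hcs)
  have hk : k ≠ 0 := by
    rintro rfl
    exact hd.1 (pow_zero c)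
  refine ⟨hdb.of_pow hc.1 hk, ?_⟩
  rw [length_pow] at hdl
  have := Nat.le_mul_of_pos_left c.length (Nat.pos_of_ne_zero hk)
  omega

/-- Either some `b ∈ B` can be inserted between `U` and `V` with few coincidences, or all `b ∈ B`
conjugate a fixed word `s` to a fixed word `e`. In the second case `B` has a common period `c` on
the left and, by reversal, one on the right; the latter, read at the start of `b`, is a word
commuting with `c` of a fixed length, so it does not depend on `b`. -/
theorem exists_common_period {U V B : Finset (FreeMonoid α)} (hB : B.Nonempty)
    (hU : ∀ b ∈ B, ∀ u ∈ U, u.length ≤ b.length) (hV : ∀ b ∈ B, ∀ v ∈ V, v.length ≤ b.length) :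
    (∃ b ∈ B, U.card * V.card ≤ 6 * ((U ×ˢ V).image fun x => x.1 * b * x.2).card) ∨
      ∃ s e, s ≠ 1 ∧ ∀ b ∈ B, s.length ≤ b.length ∧ s * b = b * e := by
  by_cases hlarge : ∃ b ∈ B, U.card * V.card ≤ 6 * ((U ×ˢ V).image fun x => x.1 * b * x.2).card
  · exact Or.inl hlarge
  right
  have hinj : Function.Injective (reverse : FreeMonoid α → FreeMonoid α) :=
    Function.LeftInverse.injective (g := reverse) fun _ => reverse_reverse
  obtain ⟨c, hc1, hc⟩ := (exists_common_left_period (V := V) hB hU).resolve_left hlarge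
  obtain ⟨e, he1, he⟩ := (exists_common_left_period (U := V.image reverse) (V := U.image reverse)
      (B := B.image reverse) (hB.image _) (by
        simp only [Finset.mem_image, forall_exists_index, and_imp, forall_apply_eq_imp_iff₂,
          length_reverse]
        exact hV)).resolve_left (by
    rintro ⟨_, hb', hle⟩
    obtain ⟨b, hb, rfl⟩ := Finset.mem_image.mp hb'
    refine hlarge ⟨b, hb, ?_⟩
    rw [Finset.card_image_of_injective _ hinj, Finset.card_image_of_injective _ hinj,
      mul_comm] at hle
    refine hle.trans (Nat.mul_le_mul_left 6 ?_)
    rw [← Finset.card_image_of_injective ((U ×ˢ V).image fun x => x.1 * b * x.2) hinj]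
    refine Finset.card_le_card fun w hw => ?_
    simp only [Finset.mem_image, Finset.mem_product, Prod.exists] at hw ⊢
    obtain ⟨_, _, ⟨⟨v, hv, rfl⟩, ⟨u, hu, rfl⟩⟩, rfl⟩ := hw
    exact ⟨_, ⟨u, v, ⟨hu, hv⟩, rfl⟩, by simp [reverse_mul, mul_assoc]⟩)
  have hs : ∀ b ∈ B, ∃ s, s * b = b * e.reverse ∧ s.length = e.length ∧ Commute s c ∧
      s.length ≤ b.length := by
    intro b hb
    obtain ⟨⟨t, ht⟩, hl⟩ := he _ (Finset.mem_image_of_mem _ hb)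
    have h1 := congrArg reverse ht
    simp only [reverse_mul, reverse_reverse] at h1
    have h2 : t.length = e.length := by
      have := congrArg length ht
      simp only [length_mul] at this
      omega
    rw [length_reverse] at hl
    refine ⟨t.reverse, h1.symm, by rw [length_reverse, h2], ?_,
      by rw [length_reverse]; omega⟩
    refine IsPeriod.commute ⟨_, h1.symm⟩ (hc b hb).1 ?_
    have := (hc b hb).2
    rw [length_reverse]
    omega
  obtain ⟨b₀, hb₀⟩ := hB
  obtain ⟨s, -, hsl, hsc, -⟩ := hs b₀ hb₀
  refine ⟨s, e.reverse, ?_, fun b hb => ?_⟩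
  · rintro rfl
    exact he1 (length_eq_zero.mp hsl.symm)
  · obtain ⟨s', hs', hsl', hsc', hsb⟩ := hs b hb
    rw [eq_of_commute_of_length_eq hc1 hsc hsc' (hsl.trans hsl'.symm)]
    exact ⟨hsb, hs'⟩

end Triple

end FreeMonoid

/-! ### Centralizers in free groups -/

namespace FreeGroup

variable {X : Type*}

/-- If `z ≠ 1` starts with the generator `c` or its inverse and `d ≠ c`, then `d * z` is reduced as
written. A reduced form of `z * d` of the same length begins with `z`, hence not with `d`. -/
theorem eq_one_of_forall_commute_of [Nontrivial X] {z : FreeGroup X}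
    (h : ∀ x, Commute z (of x)) : z = 1 := by
  classical
  by_contra hz
  obtain ⟨⟨c, ε⟩, w, hw⟩ := List.exists_cons_of_ne_nil (mt toWord_eq_nil_iff.mp hz)
  obtain ⟨d, hd⟩ := exists_ne c
  have hred : IsReduced ((d, true) :: (c, ε) :: w) :=
    List.isChain_cons_cons.mpr ⟨fun h => absurd h hd, hw ▸ isReduced_toWord⟩
  have h1 : (of d * z).toWord = (d, true) :: (c, ε) :: w := by
    rw [toWord_mul, toWord_of, hw]
    exact hred.reduce_eq
  have h2 := toWord_mul_sublist z (of d)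
  rw [(h d).eq, h1, hw, toWord_of] at h2
  have h3 := h2.eq_of_length (by simp)
  simp only [List.cons_append, List.cons.injEq, Prod.mk.injEq] at h3
  exact hd h3.1.1

theorem isCyclic_of_subsingleton [Subsingleton X] : IsCyclic (FreeGroup X) := by
  rcases isEmpty_or_nonempty X with hX | ⟨⟨x⟩⟩
  · infer_instance
  · refine ⟨of x, fun g => ?_⟩
    have h : (⊤ : Subgroup (FreeGroup X)) ≤ Subgroup.zpowers (of x) := by
      rw [← closure_range_of, Subgroup.closure_le]
      rintro _ ⟨y, rfl⟩
      rw [Subsingleton.elim y x]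
      exact Subgroup.mem_zpowers _
    exact h (Subgroup.mem_top g)

end FreeGroup

namespace IsFreeGroup

variable {G : Type*} [Group G] [IsFreeGroup G]

theorem isCyclic_of_subsingleton_generators [Subsingleton (Generators G)] : IsCyclic G :=
  have := FreeGroup.isCyclic_of_subsingleton (X := Generators G)
  isCyclic_of_surjective (mulEquiv G) (mulEquiv G).surjective

theorem isCyclic_of_central {z : G} (hz : z ≠ 1) (h : ∀ g, Commute z g) : IsCyclic G := by
  rcases subsingleton_or_nontrivial (Generators G) with hX | hX
  · exact isCyclic_of_subsingleton_generators
  · refine absurd ?_ hz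
    rw [← (mulEquiv G).symm.map_eq_one_iff]
    refine FreeGroup.eq_one_of_forall_commute_of fun x => ?_
    have := (h (mulEquiv G (FreeGroup.of x))).map (mulEquiv G).symm
    rwa [MulEquiv.symm_apply_apply] at this

/-- A free group generated by two elements `g` and `c`, all of whose homomorphisms to `ℤ` vanish
at `c`, has rank at most one: of two homomorphisms to `ℤ`, a nontrivial combination vanishes at `g`
too. -/
theorem isCyclic_of_closure_pair {S : Set G} (hS : Subgroup.closure S = ⊤) {g c : G}
    (hsub : S ⊆ {g, c}) (hc : ∀ ψ : G →* Multiplicative ℤ, ψ c = 1) : IsCyclic G := by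
  classical
  rcases subsingleton_or_nontrivial (Generators G) with hX | ⟨⟨a, b, hab⟩⟩
  · exact isCyclic_of_subsingleton_generators
  exfalso
  have hext : ∀ f₁ f₂ : G →* Multiplicative ℤ, f₁ g = f₂ g → f₁ = f₂ := by
    intro f₁ f₂ h
    refine MonoidHom.eq_of_eqOn_dense hS fun x hx => ?_
    rcases hsub hx with rfl | hx
    · exact h
    · rw [Set.mem_singleton_iff.mp hx, hc, hc]
  let ψ : Generators G → G →* Multiplicative ℤ := fun x =>
    lift fun y => if y = x then Multiplicative.ofAdd 1 else 1
  have hψ : ∀ x y, ψ x (of y) = if y = x then Multiplicative.ofAdd 1 else 1 := fun x y =>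
    lift_of _ y
  have h1 : (zpowGroupHom (ψ b g).toAdd).comp (ψ a) = (zpowGroupHom (ψ a g).toAdd).comp (ψ b) := by
    refine hext _ _ ?_
    simp only [MonoidHom.comp_apply, zpowGroupHom_apply]
    apply Multiplicative.toAdd.injective
    simp only [toAdd_zpow, smul_eq_mul, mul_comm]
  have h2 := DFunLike.congr_fun h1 (of a)
  simp only [MonoidHom.comp_apply, zpowGroupHom_apply, hψ, if_true, if_neg hab, one_zpow] at h2
  have h3 : ψ b g = 1 := by
    apply Multiplicative.toAdd.injective
    have := congrArg Multiplicative.toAdd h2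
    simpa using this
  have h4 := DFunLike.congr_fun (hext (ψ b) 1 h3) (of b)
  rw [hψ, if_pos rfl, MonoidHom.one_apply] at h4
  exact absurd (congrArg Multiplicative.toAdd h4) (by simp)

end IsFreeGroup

namespace FreeGroup

variable {X : Type*}

/-- Centralizers of nontrivial elements of a free group are cyclic, being free groups with
nontrivial centre. -/
theorem exists_centralizer_le_zpowers {s : FreeGroup X} (hs : s ≠ 1) :
    ∃ c, Commute c s ∧ ∀ x, Commute x s → x ∈ Subgroup.zpowers c := by
  let C : Subgroup (FreeGroup X) := Subgroup.centralizer {s}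
  have hC : ∀ x, x ∈ C ↔ Commute x s := fun x => by
    rw [Subgroup.mem_centralizer_singleton_iff]
    exact ⟨fun h => h, fun h => h⟩
  have hcyc : IsCyclic C := by
    refine IsFreeGroup.isCyclic_of_central (z := ⟨s, (hC s).mpr (Commute.refl s)⟩)
      (fun h => hs (congrArg Subtype.val h)) fun g => Subtype.ext ?_
    exact ((hC g).mp g.2).symm.eq
  obtain ⟨c, hc⟩ := hcyc.exists_generator
  refine ⟨c, (hC c).mp c.2, fun x hx => ?_⟩
  obtain ⟨k, hk⟩ := Subgroup.mem_zpowers_iff.mp (hc ⟨x, (hC x).mpr hx⟩)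
  exact Subgroup.mem_zpowers_iff.mpr ⟨k, congrArg Subtype.val hk⟩

theorem commute_of_commute_of_commute {s x y : FreeGroup X} (hs : s ≠ 1) (hx : Commute x s)
    (hy : Commute y s) : Commute x y := by
  obtain ⟨c, -, hc⟩ := exists_centralizer_le_zpowers hs
  obtain ⟨i, rfl⟩ := Subgroup.mem_zpowers_iff.mp (hc x hx)
  obtain ⟨j, rfl⟩ := Subgroup.mem_zpowers_iff.mp (hc y hy)
  exact (Commute.refl c).zpow_zpow i j

/-- For `i = j` this is transitivity of commutation. For `i ≠ j` the relation kills `c` in every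
homomorphism to `ℤ`, so the free subgroup generated by `g` and `c` has rank at most one. -/
theorem commute_of_conj_zpow_eq {g c : FreeGroup X} {i j : ℤ} (h : g * c ^ i * g⁻¹ = c ^ j)
    (hi : c ^ i ≠ 1) : Commute g c := by
  by_cases hij : i = j
  · subst hij
    exact commute_of_commute_of_commute hi (mul_inv_eq_iff_eq_mul.mp h)
      ((Commute.refl c).zpow_right i)
  let H := Subgroup.closure {g, c}
  let g' : H := ⟨g, Subgroup.subset_closure (by simp)⟩
  let c' : H := ⟨c, Subgroup.subset_closure (by simp)⟩
  have h' : g' * c' ^ i * g'⁻¹ = c' ^ j := Subtype.ext (by simpa [g', c'] using h)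
  have hcyc : IsCyclic H := by
    refine IsFreeGroup.isCyclic_of_closure_pair (g := g') (c := c')
      (Subgroup.closure_closure_coe_preimage (k := {g, c})) ?_ fun ψ => ?_
    · rintro ⟨x, hx⟩ (hx' | hx')
      · exact Or.inl (Subtype.ext hx')
      · exact Or.inr (Subtype.ext hx')
    · have h1 : ψ g' * ψ c' ^ i * (ψ g')⁻¹ = ψ c' ^ j := by
        rw [← map_zpow, ← map_zpow, ← h', _root_.map_mul, _root_.map_mul, _root_.map_inv]
      rw [mul_inv_cancel_comm] at h1
      have h2 := congrArg Multiplicative.toAdd h1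
      simp only [toAdd_zpow, smul_eq_mul] at h2
      apply Multiplicative.toAdd.injective
      by_contra hne
      exact hij (mul_right_cancel₀ hne h2)
  obtain ⟨t, ht⟩ := hcyc.exists_generator
  obtain ⟨m, hm⟩ := Subgroup.mem_zpowers_iff.mp (ht g')
  obtain ⟨n, hn⟩ := Subgroup.mem_zpowers_iff.mp (ht c')
  have h3 : Commute g' c' := by
    rw [← hm, ← hn]
    exact (Commute.refl t).zpow_zpow m n
  exact congrArg Subtype.val h3.eq

/-- The centralizer of a nontrivial element of a free group is malnormal. -/
theorem commute_of_conj_mem_centralizer {s g x y : FreeGroup X} (hs : s ≠ 1) (hx : Commute x s)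
    (hy : Commute y s) (hx1 : x ≠ 1) (h : g * y * g⁻¹ = x) : Commute g s := by
  obtain ⟨c, -, hc⟩ := exists_centralizer_le_zpowers hs
  obtain ⟨i, rfl⟩ := Subgroup.mem_zpowers_iff.mp (hc y hy)
  obtain ⟨j, rfl⟩ := Subgroup.mem_zpowers_iff.mp (hc x hx)
  obtain ⟨k, rfl⟩ := Subgroup.mem_zpowers_iff.mp (hc s (Commute.refl s))
  refine (commute_of_conj_zpow_eq h ?_).zpow_right k
  intro h1
  rw [h1] at h
  exact hx1 (by simpa using h.symm)

/-- If `A` contains a large part `B` of a coset of a centralizer, then either `B * {c} * B` has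
`|B| ^ 2` elements for some `c ∈ A`, or, by malnormality, all of `A` lies in that centralizer. -/
theorem sq_card_le_card_pow_three_or_commute [DecidableEq (FreeGroup X)]
    {A B : Finset (FreeGroup X)} (hBA : B ⊆ A) (hB : 1 < B.card) {s e : FreeGroup X} (hs : s ≠ 1)
    (h : ∀ b ∈ B, s * b = b * e) :
    B.card ^ 2 ≤ (A ^ 3).card ∨ ∀ a ∈ A, ∀ a' ∈ A, Commute a a' := by
  obtain ⟨b₀, h₀, b₁, h₁, hne⟩ := Finset.one_lt_card.mp hB
  have hcom : ∀ b ∈ B, ∀ b' ∈ B, Commute (b * b'⁻¹) s := by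
    intro b hb b' hb'
    have e1 : e = b⁻¹ * (s * b) := by rw [h b hb, inv_mul_cancel_left]
    have e2 : b'⁻¹ * s = e * b'⁻¹ := by
      rw [eq_mul_inv_iff_mul_eq, mul_assoc, h b' hb', inv_mul_cancel_left]
    change b * b'⁻¹ * s = s * (b * b'⁻¹)
    rw [mul_assoc, e2, ← mul_assoc, ← mul_assoc, h b hb]
  by_cases hall : ∀ c ∈ A, Commute (b₀ * c) s
  · right
    have hb₀ : Commute b₀ s := by
      refine commute_of_conj_mem_centralizer (y := (b₀ * b₀)⁻¹ * (b₀ * b₁)) hs (hcom b₁ h₁ b₀ h₀)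
        ((hall b₀ (hBA h₀)).inv_left.mul_left (hall b₁ (hBA h₁))) ?_ (by group)
      intro h1
      exact hne (mul_inv_eq_one.mp h1).symm
    have hA : ∀ a ∈ A, Commute a s := by
      intro a ha
      have := hb₀.inv_left.mul_left (hall a ha)
      rwa [inv_mul_cancel_left] at this
    exact fun a ha a' ha' => commute_of_commute_of_commute hs (hA a ha) (hA a' ha')
  · left
    push Not at hall
    obtain ⟨c, hc, hcs⟩ := hall
    rw [sq, ← Finset.card_product]
    refine Finset.card_le_card_of_injOn (fun x => x.1 * c * x.2) ?_ ?_
    · rintro ⟨b, b'⟩ hb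
      simp only [Finset.coe_product, Set.mem_prod, Finset.mem_coe] at hb
      simp only [pow_succ, pow_zero, one_mul, Finset.mem_coe]
      exact Finset.mul_mem_mul (Finset.mul_mem_mul (hBA hb.1) hc) (hBA hb.2)
    · rintro ⟨x, x'⟩ hx ⟨y, y'⟩ hy hxy
      simp only [Finset.coe_product, Set.mem_prod, Finset.mem_coe] at hx hy hxy
      by_cases hxy' : x = y
      · subst hxy'
        rw [mul_left_cancel hxy]
      · refine absurd ?_ hcs
        refine commute_of_conj_mem_centralizer (y := y' * x'⁻¹)
          (x := (b₀ * y⁻¹) * (x * b₀⁻¹)) hs ((hcom _ h₀ _ hy.1).mul_left (hcom _ hx.1 _ h₀))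
          (hcom _ hy.2 _ hx.2) ?_ ?_
        · intro h1
          apply hxy'
          have : y⁻¹ * x = 1 := by
            have := congrArg (fun t => b₀⁻¹ * t * b₀) h1
            simpa [mul_assoc] using this
          exact (inv_mul_eq_one.mp this).symm
        · have hx : x = y * c * y' * x'⁻¹ * c⁻¹ := by
            rw [← hxy]
            group
          rw [hx]
          group

end FreeGroup

/-! ### Cancellation-free products -/

namespace FreeGroup

variable {X : Type*} [DecidableEq X]

/-- The first letter of the reduced word of `a`, if `a ≠ 1`. The last letter of `a` is recorded as
`firstLetter a⁻¹`, so that `a * b` is reduced as written when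
`firstLetter a⁻¹ ≠ firstLetter b`. -/
def firstLetter (a : FreeGroup X) : Option (X × Bool) := a.toWord.head?

theorem firstLetter_eq_none {a : FreeGroup X} : firstLetter a = none ↔ a = 1 := by
  rw [firstLetter, List.head?_eq_none_iff, toWord_eq_nil_iff]

theorem firstLetter_inv (a : FreeGroup X) :
    firstLetter a⁻¹ = a.toWord.getLast?.map fun x => (x.1, !x.2) := by
  rw [firstLetter, toWord_inv, invRev, List.head?_reverse, List.getLast?_map]

theorem isReduced_append {a b : FreeGroup X} (h : firstLetter a⁻¹ ≠ firstLetter b) :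
    IsReduced (a.toWord ++ b.toWord) := by
  refine List.isChain_append.mpr ⟨isReduced_toWord, isReduced_toWord, ?_⟩
  intro x hx y hy hxy
  by_contra hne
  apply h
  rw [firstLetter_inv, firstLetter, Option.mem_def.mp hx, Option.mem_def.mp hy, Option.map_some,
    Option.some_inj]
  exact Prod.ext hxy (Bool.not_eq.mpr hne)

theorem toWord_mul_mul {a b c : FreeGroup X} (hb : b ≠ 1) (hab : firstLetter a⁻¹ ≠ firstLetter b)
    (hbc : firstLetter b⁻¹ ≠ firstLetter c) :
    (a * b * c).toWord = a.toWord ++ b.toWord ++ c.toWord := by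
  have h := ((isReduced_append hab).append_overlap (isReduced_append hbc)
    (mt toWord_eq_nil_iff.mp hb)).reduce_eq
  rw [← h, toWord_mul, toWord_mul, (isReduced_append hab).reduce_eq]

theorem toWord_mk_singleton_inv_mul {a : FreeGroup X} {x : X × Bool} {w : List (X × Bool)}
    (h : a.toWord = x :: w) : ((mk [x])⁻¹ * a).toWord = w := by
  have h1 : (mk [x])⁻¹ * a = mk w := by
    rw [inv_mul_eq_iff_eq_mul, mul_mk, ← mk_toWord (x := a), h, List.singleton_append]
  have h2 : IsReduced (x :: w) := h ▸ isReduced_toWord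
  rw [h1, toWord_mk, (h2.infix ⟨[x], [], by simp⟩).reduce_eq]

theorem norm_singleton_inv_mul {a : FreeGroup X} {x : X × Bool} (h : firstLetter a = some x) :
    norm ((mk [x])⁻¹ * a) + 1 = norm a := by
  obtain ⟨w, hw⟩ := List.head?_eq_some_iff.mp h
  rw [norm, toWord_mk_singleton_inv_mul hw, norm, hw, List.length_cons]

theorem firstLetter_inv_singleton_inv_mul {a : FreeGroup X} {x : X × Bool}
    (h : firstLetter a = some x) (h' : firstLetter a⁻¹ = some x) :
    firstLetter ((mk [x])⁻¹ * a)⁻¹ = some x := by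
  obtain ⟨w, hw⟩ := List.head?_eq_some_iff.mp h
  rw [firstLetter_inv, hw] at h'
  rw [firstLetter_inv, toWord_mk_singleton_inv_mul hw]
  rcases w with _ | ⟨y, w⟩
  · rcases x with ⟨c, _ | _⟩ <;> simp at h'
  · rwa [List.getLast?_cons_cons] at h'

theorem norm_conj_add_le (a : FreeGroup X) (x : X × Bool) :
    norm ((mk [x])⁻¹ * a * mk [x]) + ((if firstLetter a = some x then 2 else 0) +
      (if firstLetter a⁻¹ = some x then 2 else 0)) ≤ norm a + 2 := by
  have hx : norm (mk [x]) ≤ 1 := norm_mk_le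
  have hmul : ∀ b : FreeGroup X, norm (b * mk [x]) = norm ((mk [x])⁻¹ * b⁻¹) := fun b => by
    rw [← mul_inv_rev, norm_inv_eq]
  have hle : ∀ b : FreeGroup X, norm ((mk [x])⁻¹ * b) ≤ norm b + 1 := fun b => by
    have := norm_mul_le (mk [x])⁻¹ b
    rw [norm_inv_eq] at this
    omega
  rw [hmul]
  have h1 := hle a
  have h2 := hle ((mk [x])⁻¹ * a)⁻¹
  rw [norm_inv_eq] at h2
  by_cases hi : firstLetter a = some x
  · have h3 := norm_singleton_inv_mul hi
    by_cases ht : firstLetter a⁻¹ = some x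
    · have h4 := norm_singleton_inv_mul (firstLetter_inv_singleton_inv_mul hi ht)
      rw [norm_inv_eq] at h4
      simp only [hi, ht, if_true]
      omega
    · simp only [hi, ht, if_true, if_false]
      omega
  · by_cases ht : firstLetter a⁻¹ = some x
    · have h3 := norm_singleton_inv_mul ht
      rw [norm_inv_eq] at h3
      have h4 : norm ((mk [x])⁻¹ * ((mk [x])⁻¹ * a)⁻¹) ≤ norm ((mk [x])⁻¹ * a⁻¹) + 1 := by
        have h5 : (mk [x])⁻¹ * ((mk [x])⁻¹ * a)⁻¹ = (mk [x])⁻¹ * a⁻¹ * mk [x] := by group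
        rw [h5]
        have := norm_mul_le ((mk [x])⁻¹ * a⁻¹) (mk [x])
        omega
      simp only [hi, ht, if_true, if_false]
      omega
    · simp only [hi, ht, if_false]
      omega

/-- Conjugating `A` so that the sum of its word lengths is as small as possible, no letter is both
the first letter of most elements and the inverse of the last letter of most elements. -/
theorem exists_conj_balanced (A : Finset (FreeGroup X)) :
    ∃ g : FreeGroup X, ∀ x, ((A.image (MulAut.conj g)).filter fun a => firstLetter a = some x).card
      + ((A.image (MulAut.conj g)).filter fun a => firstLetter a⁻¹ = some x).card
        ≤ (A.image (MulAut.conj g)).card := by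
  classical
  have hex : ∃ n, ∃ g : FreeGroup X, ∑ a ∈ A, norm (MulAut.conj g a) = n := ⟨_, 1, rfl⟩
  obtain ⟨g, hg⟩ := Nat.find_spec hex
  refine ⟨g, fun x => ?_⟩
  have hmin : ∑ a ∈ A, norm (MulAut.conj g a) ≤
      ∑ a ∈ A, norm (MulAut.conj ((mk [x])⁻¹ * g) a) :=
    hg.le.trans (Nat.find_min' hex ⟨_, rfl⟩)
  have hinj := (MulAut.conj g).injective
  have h1 : ∑ a ∈ A.image (MulAut.conj g), norm a ≤
      ∑ a ∈ A.image (MulAut.conj g), norm ((mk [x])⁻¹ * a * mk [x]) := by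
    rw [Finset.sum_image hinj.injOn, Finset.sum_image hinj.injOn]
    refine hmin.trans (Finset.sum_le_sum fun a _ => le_of_eq ?_)
    rw [_root_.map_mul, MulAut.mul_apply, MulAut.conj_apply (mk [x])⁻¹, inv_inv]
  have h2 := Finset.sum_le_sum fun a (_ : a ∈ A.image (MulAut.conj g)) => norm_conj_add_le a x
  simp only [Finset.sum_add_distrib, ← Finset.sum_filter, Finset.sum_const, smul_eq_mul] at h2
  omega

/-- The reduced word of `a` starts with a letter from `S`. -/
def StartsIn (S : Finset (X × Bool)) (a : FreeGroup X) : Prop := ∃ x ∈ S, firstLetter a = some x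

theorem StartsIn.ne_one {S : Finset (X × Bool)} {a : FreeGroup X} (h : StartsIn S a) : a ≠ 1 := by
  obtain ⟨x, -, hx⟩ := h
  intro h1
  rw [firstLetter_eq_none.mpr h1] at hx
  exact absurd hx (by simp)

theorem StartsIn.firstLetter_ne {S : Finset (X × Bool)} {a b : FreeGroup X} (ha : StartsIn S a)
    (hb : ¬ StartsIn S b) : firstLetter a ≠ firstLetter b := fun h => hb <| by
  obtain ⟨x, hx, hx'⟩ := ha
  exact ⟨x, hx, h ▸ hx'⟩

theorem StartsIn.erase_or_erase {S : Finset (X × Bool)} {a : FreeGroup X} (h : StartsIn S a)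
    {x y : X × Bool} (hxy : x ≠ y) : StartsIn (S.erase x) a ∨ StartsIn (S.erase y) a := by
  obtain ⟨z, hz, hz'⟩ := h
  by_cases hzx : z = x
  · exact Or.inr ⟨z, Finset.mem_erase.mpr ⟨hzx ▸ hxy, hz⟩, hz'⟩
  · exact Or.inl ⟨z, Finset.mem_erase.mpr ⟨hzx, hz⟩, hz'⟩

open Classical in
/-- A minimal set of letters that is met, at the start or at the end, by a quarter of the elements
of `A` is met at both ends by at most half of them: it is either a single letter, or the union of
two sets each met by less than a quarter. -/
theorem exists_letters (A : Finset (FreeGroup X))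
    (hA : ∀ x, (A.filter fun a => firstLetter a = some x).card +
      (A.filter fun a => firstLetter a⁻¹ = some x).card ≤ A.card) :
    ∃ S : Finset (X × Bool),
      A.card ≤ 4 * (A.filter fun a => StartsIn S a ∨ StartsIn S a⁻¹).card + 1 ∧
      2 * (A.filter fun a => StartsIn S a ∧ StartsIn S a⁻¹).card ≤ A.card := by
  have main : ∀ S : Finset (X × Bool),
      A.card ≤ 4 * (A.filter fun a => StartsIn S a ∨ StartsIn S a⁻¹).card + 1 →
      ∃ S : Finset (X × Bool),
        A.card ≤ 4 * (A.filter fun a => StartsIn S a ∨ StartsIn S a⁻¹).card + 1 ∧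
        2 * (A.filter fun a => StartsIn S a ∧ StartsIn S a⁻¹).card ≤ A.card := by
    intro S
    induction S using Finset.strongInduction with
    | H S ih =>
    intro hS
    by_cases hred : ∃ x ∈ S,
        A.card ≤ 4 * (A.filter fun a => StartsIn (S.erase x) a ∨ StartsIn (S.erase x) a⁻¹).card + 1
    · obtain ⟨x, hx, hS'⟩ := hred
      exact ih _ (Finset.erase_ssubset hx) hS'
    push Not at hred
    refine ⟨S, hS, ?_⟩
    by_cases hsub : ∃ x ∈ S, ∃ y ∈ S, x ≠ y
    · obtain ⟨x, hx, y, hy, hxy⟩ := hsub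
      have h1 := hred x hx
      have h2 := hred y hy
      have h3 : (A.filter fun a => StartsIn S a ∧ StartsIn S a⁻¹) ⊆
          (A.filter fun a => StartsIn (S.erase x) a ∨ StartsIn (S.erase x) a⁻¹) ∪
          (A.filter fun a => StartsIn (S.erase y) a ∨ StartsIn (S.erase y) a⁻¹) := by
        intro a ha
        simp only [Finset.mem_union, Finset.mem_filter] at ha ⊢
        rcases ha.2.1.erase_or_erase hxy with h | h
        · exact Or.inl ⟨ha.1, Or.inl h⟩
        · exact Or.inr ⟨ha.1, Or.inl h⟩
      have h4 := (Finset.card_le_card h3).trans (Finset.card_union_le _ _)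
      omega
    · push Not at hsub
      rcases S.eq_empty_or_nonempty with rfl | ⟨x, hx⟩
      · simp [StartsIn]
      · have hst : ∀ a, StartsIn S a → firstLetter a = some x := by
          rintro a ⟨y, hy, hay⟩
          rw [hay, hsub y hy x hx]
        have h1 : (A.filter fun a => StartsIn S a ∧ StartsIn S a⁻¹) ⊆
            A.filter fun a => firstLetter a = some x := fun a ha => by
          simp only [Finset.mem_filter] at ha ⊢
          exact ⟨ha.1, hst a ha.2.1⟩
        have h2 : (A.filter fun a => StartsIn S a ∧ StartsIn S a⁻¹) ⊆
            A.filter fun a => firstLetter a⁻¹ = some x := fun a ha => by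
          simp only [Finset.mem_filter] at ha ⊢
          exact ⟨ha.1, hst a⁻¹ ha.2.2⟩
        have h3 := Finset.card_le_card h1
        have h4 := Finset.card_le_card h2
        have h5 := hA x
        omega
  refine main (Finset.eraseNone (A.image firstLetter)) ?_
  have hsub : A.erase 1 ⊆ A.filter fun a => StartsIn (Finset.eraseNone (A.image firstLetter)) a ∨
      StartsIn (Finset.eraseNone (A.image firstLetter)) a⁻¹ := by
    intro a ha
    obtain ⟨ha1, ha⟩ := Finset.mem_erase.mp ha
    obtain ⟨x, hx⟩ := Option.ne_none_iff_exists'.mp (mt firstLetter_eq_none.mp ha1)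
    refine Finset.mem_filter.mpr ⟨ha, Or.inl ⟨x, ?_, hx⟩⟩
    rw [Finset.mem_eraseNone, ← hx]
    exact Finset.mem_image_of_mem _ ha
  have h1 := Finset.card_le_card hsub
  have h2 := Finset.pred_card_le_card_erase (s := A) (a := (1 : FreeGroup X))
  omega

end FreeGroup

namespace Finset

variable {β : Type*}

theorem exists_median (P : Finset β) (f : β → ℕ) {k : ℕ} (hP : 2 * k ≤ P.card) :
    ∃ m, k ≤ (P.filter fun a => f a ≤ m).card ∧ k ≤ (P.filter fun a => m ≤ f a).card := by
  have hex : ∃ m, k ≤ (P.filter fun a => f a ≤ m).card := by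
    refine ⟨P.sup f, ?_⟩
    rw [filter_true_of_mem fun a ha => le_sup ha]
    omega
  classical
  refine ⟨Nat.find hex, Nat.find_spec hex, ?_⟩
  rcases Nat.eq_zero_or_pos (Nat.find hex) with h0 | hpos
  · rw [h0]
    simp only [zero_le, filter_true]
    omega
  · have h1 := Nat.find_min hex (Nat.sub_lt hpos one_pos)
    have h2 := card_filter_add_card_filter_not (s := P) fun a => f a ≤ Nat.find hex - 1
    have h3 : (P.filter fun a => ¬ f a ≤ Nat.find hex - 1) =
        P.filter fun a => Nat.find hex ≤ f a := filter_congr fun a _ => by omega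
    rw [h3] at h2
    omega

/-- One of two large sets has many elements that are all at least as large as many elements of the
other one. -/
theorem exists_subsets_le (P Q : Finset β) (f : β → ℕ) {k : ℕ} (hP : 2 * k ≤ P.card)
    (hQ : 2 * k ≤ Q.card) :
    ∃ U B : Finset β, (U ⊆ P ∧ B ⊆ Q ∨ U ⊆ Q ∧ B ⊆ P) ∧ k ≤ U.card ∧ k ≤ B.card ∧
      ∀ u ∈ U, ∀ b ∈ B, f u ≤ f b := by
  obtain ⟨m, hm1, hm2⟩ := exists_median P f hP
  obtain ⟨l, hl1, hl2⟩ := exists_median Q f hQ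
  rcases le_total m l with h | h
  · exact ⟨_, _, Or.inl ⟨filter_subset _ _, filter_subset _ _⟩, hm1, hl2, fun u hu b hb =>
      ((mem_filter.mp hu).2.trans h).trans (mem_filter.mp hb).2⟩
  · exact ⟨_, _, Or.inr ⟨filter_subset _ _, filter_subset _ _⟩, hl1, hm2, fun u hu b hb =>
      ((mem_filter.mp hu).2.trans h).trans (mem_filter.mp hb).2⟩

end Finset

namespace FreeGroup

variable {X : Type*} [DecidableEq X]

/-- The elements of `A` are sorted by whether their first letter and the inverse of their last
letter lie in the set `S` of `exists_letters`. Either one of the two mixed classes is large, and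
all products within it are reduced, or both unmixed classes are large, and all products between
them are reduced. -/
theorem exists_reduced_subsets (A : Finset (FreeGroup X)) {k : ℕ} (hk : 24 * k + 2 ≤ A.card)
    (hA : ∀ x, (A.filter fun a => firstLetter a = some x).card +
      (A.filter fun a => firstLetter a⁻¹ = some x).card ≤ A.card) :
    ∃ U B : Finset (FreeGroup X), U ⊆ A ∧ B ⊆ A ∧ k ≤ U.card ∧ k ≤ B.card ∧
      ∀ u ∈ U, ∀ b ∈ B, norm u ≤ norm b ∧ b ≠ 1 ∧ firstLetter u⁻¹ ≠ firstLetter b ∧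
        firstLetter b⁻¹ ≠ firstLetter u := by
  classical
  -- It suffices to find two large classes all of whose products, in both orders, are reduced.
  have main : ∀ P Q : Finset (FreeGroup X), P ⊆ A → Q ⊆ A → 2 * k ≤ P.card → 2 * k ≤ Q.card →
      (∀ p ∈ P, p ≠ 1) → (∀ q ∈ Q, q ≠ 1) →
      (∀ p ∈ P, ∀ q ∈ Q, firstLetter p⁻¹ ≠ firstLetter q ∧ firstLetter q⁻¹ ≠ firstLetter p) →
      ∃ U B : Finset (FreeGroup X), U ⊆ A ∧ B ⊆ A ∧ k ≤ U.card ∧ k ≤ B.card ∧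
      ∀ u ∈ U, ∀ b ∈ B, norm u ≤ norm b ∧ b ≠ 1 ∧ firstLetter u⁻¹ ≠ firstLetter b ∧
        firstLetter b⁻¹ ≠ firstLetter u := by
    intro P Q hP hQ hPk hQk hP1 hQ1 hPQ
    obtain ⟨U, B, ⟨hU, hB⟩ | ⟨hU, hB⟩, hUk, hBk, hUB⟩ := P.exists_subsets_le Q norm hPk hQk
    · exact ⟨U, B, hU.trans hP, hB.trans hQ, hUk, hBk, fun u hu b hb =>
        ⟨hUB u hu b hb, hQ1 b (hB hb), hPQ u (hU hu) b (hB hb)⟩⟩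
    · exact ⟨U, B, hU.trans hQ, hB.trans hP, hUk, hBk, fun u hu b hb =>
        ⟨hUB u hu b hb, hP1 b (hB hb), (hPQ b (hB hb) u (hU hu)).symm⟩⟩
  obtain ⟨S, hS1, hS2⟩ := exists_letters A hA
  let M₁ := A.filter fun a => StartsIn S a ∧ ¬ StartsIn S a⁻¹
  let M₂ := A.filter fun a => ¬ StartsIn S a ∧ StartsIn S a⁻¹
  let P := A.filter fun a => StartsIn S a ∧ StartsIn S a⁻¹
  let Q := (A.filter fun a => ¬ StartsIn S a ∧ ¬ StartsIn S a⁻¹).erase 1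
  have hinv1 : ∀ a : FreeGroup X, StartsIn S a⁻¹ → a ≠ 1 := fun a h => inv_ne_one.mp h.ne_one
  by_cases h₁ : 2 * k ≤ M₁.card
  · refine main M₁ M₁ (Finset.filter_subset _ _) (Finset.filter_subset _ _) h₁ h₁ ?_ ?_ ?_
    · exact fun p hp => (Finset.mem_filter.mp hp).2.1.ne_one
    · exact fun p hp => (Finset.mem_filter.mp hp).2.1.ne_one
    · intro p hp q hq
      obtain ⟨-, hp1, hp2⟩ := Finset.mem_filter.mp hp
      obtain ⟨-, hq1, hq2⟩ := Finset.mem_filter.mp hq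
      exact ⟨(hq1.firstLetter_ne hp2).symm, (hp1.firstLetter_ne hq2).symm⟩
  by_cases h₂ : 2 * k ≤ M₂.card
  · refine main M₂ M₂ (Finset.filter_subset _ _) (Finset.filter_subset _ _) h₂ h₂ ?_ ?_ ?_
    · exact fun p hp => hinv1 p (Finset.mem_filter.mp hp).2.2
    · exact fun p hp => hinv1 p (Finset.mem_filter.mp hp).2.2
    · intro p hp q hq
      obtain ⟨-, hp1, hp2⟩ := Finset.mem_filter.mp hp
      obtain ⟨-, hq1, hq2⟩ := Finset.mem_filter.mp hq
      exact ⟨hp2.firstLetter_ne hq1, hq2.firstLetter_ne hp1⟩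
  have hcard1 : (A.filter fun a => StartsIn S a ∨ StartsIn S a⁻¹).card ≤
      P.card + (M₁.card + M₂.card) := by
    refine (Finset.card_le_card fun a ha => ?_).trans ((Finset.card_union_le P (M₁ ∪ M₂)).trans
      (Nat.add_le_add_left (Finset.card_union_le _ _) _))
    simp only [P, M₁, M₂, Finset.mem_union, Finset.mem_filter] at ha ⊢
    tauto
  have hcard2 : A.card ≤ P.card + (M₁.card + M₂.card) + (Q.card + 1) := by
    have hcov : A ⊆ (P ∪ (M₁ ∪ M₂)) ∪ insert 1 Q := by
      intro a ha
      simp only [P, M₁, M₂, Q, Finset.mem_union, Finset.mem_filter, Finset.mem_insert,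
        Finset.mem_erase]
      tauto
    have e1 := Finset.card_le_card hcov
    have e2 := Finset.card_union_le (P ∪ (M₁ ∪ M₂)) (insert 1 Q)
    have e3 := Finset.card_union_le P (M₁ ∪ M₂)
    have e4 := Finset.card_union_le M₁ M₂
    have e5 := Finset.card_insert_le (1 : FreeGroup X) Q
    omega
  have hP2 : 2 * P.card ≤ A.card := hS2
  refine main P Q (Finset.filter_subset _ _)
    ((Finset.erase_subset _ _).trans (Finset.filter_subset _ _)) (by omega) (by omega) ?_ ?_ ?_
  · exact fun p hp => (Finset.mem_filter.mp hp).2.1.ne_one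
  · exact fun q hq => Finset.ne_of_mem_erase hq
  · intro p hp q hq
    obtain ⟨-, hp1, hp2⟩ := Finset.mem_filter.mp hp
    obtain ⟨-, hq1, hq2⟩ := Finset.mem_filter.mp (Finset.mem_of_mem_erase hq)
    exact ⟨hp2.firstLetter_ne hq1, (hp1.firstLetter_ne hq2).symm⟩

end FreeGroup

/-! ### The triple product in a free group -/

namespace FreeGroup

variable {X : Type*} [DecidableEq X]

/-- For sets of words with the cancellation-free products provided by `exists_reduced_subsets`, the
dichotomy for words becomes one for the triple product. -/
theorem card_sq_le_of_reduced_subsets {A U B : Finset (FreeGroup X)} {k : ℕ} (hUA : U ⊆ A)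
    (hBA : B ⊆ A) (hU : k ≤ U.card) (hB : k ≤ B.card) (hk : 2 ≤ k)
    (h : ∀ u ∈ U, ∀ b ∈ B, norm u ≤ norm b ∧ b ≠ 1 ∧ firstLetter u⁻¹ ≠ firstLetter b ∧
        firstLetter b⁻¹ ≠ firstLetter u) :
    k ^ 2 ≤ 6 * (A ^ 3).card ∨ ∀ a ∈ A, ∀ a' ∈ A, Commute a a' := by
  classical
  let w : FreeGroup X → FreeMonoid (X × Bool) := fun a => FreeMonoid.ofList a.toWord
  have hw : Function.Injective w := fun a b hab => toWord_injective hab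
  have hlen : ∀ b ∈ B.image w, ∀ u ∈ U.image w, u.length ≤ b.length := by
    intro b hb u hu
    obtain ⟨b₀, hb₀, rfl⟩ := Finset.mem_image.mp hb
    obtain ⟨u₀, hu₀, rfl⟩ := Finset.mem_image.mp hu
    exact (h u₀ hu₀ b₀ hb₀).1
  have hBne : (B.image w).Nonempty := Finset.Nonempty.image (Finset.card_pos.mp (by omega)) w
  rcases FreeMonoid.exists_common_period hBne hlen hlen with ⟨b', hb', hle⟩ | ⟨s, e, hs, hse⟩
  · left
    obtain ⟨b, hb, rfl⟩ := Finset.mem_image.mp hb'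
    rw [Finset.card_image_of_injective _ hw] at hle
    have hsub : ((U.image w ×ˢ U.image w).image fun x => x.1 * w b * x.2) ⊆ (A ^ 3).image w := by
      intro y hy
      simp only [Finset.mem_image, Finset.mem_product, Prod.exists] at hy
      obtain ⟨_, _, ⟨⟨u, hu, rfl⟩, ⟨v, hv, rfl⟩⟩, rfl⟩ := hy
      refine Finset.mem_image.mpr ⟨u * b * v, ?_, ?_⟩
      · simp only [pow_succ, pow_zero, one_mul]
        exact Finset.mul_mem_mul (Finset.mul_mem_mul (hUA hu) (hBA hb)) (hUA hv)
      · exact toWord_mul_mul (h u hu b hb).2.1 (h u hu b hb).2.2.1 (h v hv b hb).2.2.2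
    have h1 := Finset.card_le_card hsub
    rw [Finset.card_image_of_injective _ hw] at h1
    have h2 := Nat.mul_le_mul hU hU
    rw [sq]
    omega
  · have hmk : ∀ b ∈ B, mk s.toList * b = b * mk e.toList := by
      intro b hb
      have h1 := (hse _ (Finset.mem_image_of_mem w hb)).2
      have h2 : s.toList ++ b.toWord = b.toWord ++ e.toList := h1
      have h3 := congrArg mk h2
      rwa [← mul_mk, ← mul_mk, mk_toWord] at h3
    have hs1 : mk s.toList ≠ 1 := by
      obtain ⟨b, hb⟩ := hBne
      obtain ⟨hl, heq⟩ := hse b hb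
      obtain ⟨b, -, rfl⟩ := Finset.mem_image.mp hb
      obtain ⟨t, ht, -⟩ := FreeMonoid.exists_mul_of_mul_eq_mul heq hl
      -- `s` is a prefix of a reduced word, hence is itself reduced.
      have ht' : b.toWord = s.toList ++ t.toList := ht
      have hred : IsReduced s.toList :=
        IsReduced.infix (isReduced_toWord (x := b)) ⟨[], t.toList, by rw [ht', List.nil_append]⟩
      rw [Ne, ← toWord_eq_nil_iff, toWord_mk, hred.reduce_eq]
      exact hs
    refine (sq_card_le_card_pow_three_or_commute hBA (by omega) hs1 hmk).imp_left fun h1 => ?_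
    have h2 := Nat.pow_le_pow_left hB 2
    omega

theorem card_sq_le_or_commute (A : Finset (FreeGroup X)) (hA : 7776 ≤ A.card) :
    A.card ^ 2 ≤ 7776 * (A ^ 3).card ∨ ∀ a ∈ A, ∀ a' ∈ A, Commute a a' := by
  obtain ⟨g, hg⟩ := exists_conj_balanced A
  have hinj := (MulAut.conj g).injective
  have hcard : (A.image (MulAut.conj g)).card = A.card := Finset.card_image_of_injective _ hinj
  -- The least `k` with `A.card ≤ 36 * k`, and `7776 = 36 ^ 2 * 6`.
  obtain ⟨k, hk⟩ : ∃ k, k = (A.card + 35) / 36 := ⟨_, rfl⟩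
  obtain ⟨U, B, hUA, hBA, hU, hB, h⟩ := exists_reduced_subsets (A.image (MulAut.conj g))
    (k := k) (by omega) hg
  refine (card_sq_le_of_reduced_subsets hUA hBA hU hB (by omega) h).imp (fun h1 => ?_)
    fun h1 a ha a' ha' => ?_
  · rw [← Finset.image_pow, Finset.card_image_of_injective _ hinj] at h1
    have h2 : A.card ^ 2 ≤ (36 * k) ^ 2 := Nat.pow_le_pow_left (by omega) 2
    rw [mul_pow] at h2
    omega
  · have h2 := h1 _ (Finset.mem_image_of_mem _ ha) _ (Finset.mem_image_of_mem _ ha')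
    apply hinj
    rw [_root_.map_mul, _root_.map_mul]
    exact h2.eq

end FreeGroup

/-! ### Fully residually free groups -/

namespace IsFullyResiduallyFree

variable {G : Type u} [Group G]

theorem isMulTorsionFree (hG : IsFullyResiduallyFree G) : IsMulTorsionFree G where
  pow_left_injective n hn a b hab := by
    classical
    obtain ⟨X, θ, -, hθ⟩ := hG {a, b}
    refine hθ (by simp) (by simp) (pow_left_injective hn ?_)
    simpa using congrArg θ hab

theorem card_sq_le_or_commute [DecidableEq G] (hG : IsFullyResiduallyFree G) (A : Finset G) :
    A.card ^ 2 ≤ 7776 * (A ^ 3).card ∨ ∀ a ∈ A, ∀ a' ∈ A, Commute a a' := by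
  classical
  by_cases hcomm : ∀ a ∈ A, ∀ a' ∈ A, Commute a a'
  · exact Or.inr hcomm
  left
  push Not at hcomm
  obtain ⟨a, ha, b, hb, hab⟩ := hcomm
  have hpow : A.card ≤ (A ^ 3).card := Finset.card_le_card_pow (by norm_num)
  by_cases hsmall : A.card < 7776
  · rw [sq]
    exact Nat.mul_le_mul hsmall.le hpow
  obtain ⟨X, θ, -, hθ⟩ := hG (A ∪ {a * b, b * a})
  have hcard : (A.image θ).card = A.card :=
    Finset.card_image_of_injOn (hθ.mono fun x hx => by simp_all)
  have h1 := (FreeGroup.card_sq_le_or_commute (A.image θ) (by omega)).resolve_right fun h => by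
    have h2 := (h _ (Finset.mem_image_of_mem θ ha) _ (Finset.mem_image_of_mem θ hb)).eq
    rw [← map_mul, ← map_mul] at h2
    exact hab (hθ (by simp) (by simp) h2)
  rw [hcard, ← Finset.image_pow] at h1
  exact h1.trans (Nat.mul_le_mul_left _ Finset.card_image_le)

end IsFullyResiduallyFree

theorem isFreeAbelian_of_fg (H : Type u) [Group H] [IsMulCommutative H] [Group.FG H]
    [IsMulTorsionFree H] : IsFreeAbelian H := by
  let _ : CommGroup H := { (inferInstance : Group H) with mul_comm := mul_comm' }
  have : Module.Finite ℤ (Additive H) := Module.Finite.iff_addGroup_fg.mpr inferInstance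
  have : Module.IsTorsionFree ℤ (Additive H) :=
    Module.isTorsionFree_int_iff_isAddTorsionFree.mpr inferInstance
  have : Module.Free ℤ (Additive H) := inferInstance
  let b := Module.Free.chooseBasis ℤ (Additive H)
  exact ⟨_, ⟨(MulEquiv.toAdditiveLeft.symm
    (b.repr.toAddEquiv.trans (FreeAbelianGroup.equivFinsupp _).symm))⟩⟩

theorem corollary3p2 (G : Type u) [Group G] [DecidableEq G] (hG : IsFullyResiduallyFree G)
    (A : Finset G) :
    (1 / 7776 : ℝ) * (A.card : ℝ) ^ 2 ≤ ((A ^ 3).card : ℝ) ∨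
      IsFreeAbelian (Subgroup.closure (A : Set G)) := by
  refine (hG.card_sq_le_or_commute A).imp (fun h => ?_) fun h => ?_
  · have h' : (A.card : ℝ) ^ 2 ≤ 7776 * ((A ^ 3).card : ℝ) := by exact_mod_cast h
    linarith
  · have := hG.isMulTorsionFree
    have := Subgroup.isMulCommutative_closure (k := (A : Set G)) fun a ha b hb => (h a ha b hb).eq
    have : Group.FG (Subgroup.closure (A : Set G)) := Group.closure_finset_fg A
    exact isFreeAbelian_of_fg _
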